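/- For a finite simple graph $G$ let $\lambda(G)$ be the largest eigenvalue of its adjacency matrix. Let $r\ge 2$ be an integer. (1) There is a constant $c=c(r)>0$ such that every finite simple graph $G$ with $m$ edges and $\lambda(G)^2>\left(1-\frac1r\right)2m$ contains at least $c\,m^{(r-1)/2}$ copies of the complete graph $K_{r+1}$. (2) This bound is tight up to a constant factor: there is a constant $C=C(r)>0$ such that for every integer $t\ge 2$, every graph $G$ obtained from the complete $r$-partite graph $K_{t,t,\ldots,t}$ by adding one edge between two distinct vertices of the same part has exactly $m=\binom r2t^2+1$ edges, satisfies $\lambda(G)^2>\left(1-\frac1r\right)2m$, and contains at most $C\,m^{(r-1)/2}$ copies of $K_{r+1}$. -/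

import Mathlib

/-- The largest eigenvalue `λ(G)` of the adjacency matrix of a finite graph `G`. The adjacency
matrix is real symmetric, so its real spectrum is the (finite) set of all its eigenvalues. -/
noncomputable def graphSpectralRadius {V : Type*} [Fintype V] [DecidableEq V]
    (G : SimpleGraph V) [DecidableRel G.Adj] : ℝ :=
  sSup (spectrum ℝ (G.adjMatrix ℝ))

/-- On a nonempty vertex set `graphSpectralRadius G` is attained: it is the largest eigenvalue. -/
theorem isGreatest_graphSpectralRadius {V : Type*} [Fintype V] [DecidableEq V] [Nonempty V]
    (G : SimpleGraph V) [DecidableRel G.Adj] :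
    IsGreatest (spectrum ℝ (G.adjMatrix ℝ)) (graphSpectralRadius G) := by
  have hA : (G.adjMatrix ℝ).IsHermitian := by
    simp [Matrix.IsHermitian, Matrix.conjTranspose_eq_transpose_of_trivial]
  have h := hA.spectrum_real_eq_range_eigenvalues
  have hfin : (spectrum ℝ (G.adjMatrix ℝ)).Finite := h ▸ Set.finite_range _
  have hne : (spectrum ℝ (G.adjMatrix ℝ)).Nonempty := h ▸ Set.range_nonempty _
  exact ⟨hne.csSup_mem hfin, fun x hx => le_csSup hfin.bddAbove hx⟩

/-- The balanced complete `r`-partite graph `K_{t,…,t}`, whose parts are the sets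
`{i} × Fin t` for `i : Fin r`, together with one additional edge joining the two vertices `(i, a)`
and `(i, b)` of the part with index `i`. -/
def completePartitePlusEdge (r t : ℕ) (i : Fin r) (a b : Fin t) :
    SimpleGraph (Σ _ : Fin r, Fin t) :=
  SimpleGraph.completeMultipartiteGraph (fun _ : Fin r => Fin t) ⊔
    SimpleGraph.edge ⟨i, a⟩ ⟨i, b⟩

noncomputable instance (r t : ℕ) (i : Fin r) (a b : Fin t) :
    DecidableRel (completePartitePlusEdge r t i a b).Adj :=
  Classical.decRel _

/-! Part (1) is proved on an optimised weighted subgraph. Fix a density a slightly below 1 - 1/r.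
Over subgraphs H of G, vertex scalings s in [0,1] and nonnegative unit vectors x, maximise l² - aM.
Here l is the form of H at sx and M is its form at s², that is, twice the total edge weight. The
start H = G, s = 1, x a leading eigenvector already gives more than δm. Hence at the maximum l >
√(δm), and l² > (1 - 1/r)M still holds.

Maximality replaces regularity assumptions. Varying x gives an eigenvalue equation (`eigen`),
shrinking one s u bounds weighted degrees (`mul_nbrSum_le`), and deleting an edge bounds its weight
(`edge_le`). The continuous s makes partial deletion of a vertex a legitimate variation. It follows
that every edge of the support has an end of weighted degree at least al/2 (`le_max_nbrSum`). It
also follows that neighbours with small x v / s v carry x²-mass almost 1 - 1/r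
(`sub_le_sum_lightNbrs`).

The weighted Turán inequality puts a K_{r+1} in the support of x (`exists_clique`). Two of its
vertices p, q share light neighbours of mass above 1 - 2/r by a fixed amount
(`exists_pair_sum_inter_ge`). In this common set each vertex has mass O(1/l) and misses mass about
1/r, so greedy choice yields on the order of l^(r-1) cliques K_{r-1}. Adding p and q gives the
bound.

For part (2), every K_{r+1} must use the added edge, and the all-ones vector bounds λ from below. -/

/-- The `0`-`1` indicator of adjacency. -/
noncomputable def adjInd {V : Type*} (H : SimpleGraph V) (u v : V) : ℝ :=
  open Classical in if H.Adj u v then 1 else 0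

/-! ### Quadratic form of a graph, weighted Turán inequality, greedy clique counting. -/

section AdjForm

variable {V : Type*} (H : SimpleGraph V)

theorem adjInd_of_adj {u v : V} (h : H.Adj u v) : adjInd H u v = 1 := by simp [adjInd, h]

theorem adjInd_of_not_adj {u v : V} (h : ¬ H.Adj u v) : adjInd H u v = 0 := by simp [adjInd, h]

theorem adjInd_comm (u v : V) : adjInd H u v = adjInd H v u := by
  have h := H.adj_comm u v
  by_cases huv : H.Adj u v
  · rw [adjInd_of_adj H huv, adjInd_of_adj H (h.1 huv)]
  · rw [adjInd_of_not_adj H huv, adjInd_of_not_adj H fun h' => huv (h.2 h')]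

theorem adjInd_self (u : V) : adjInd H u u = 0 := by simp [adjInd]

theorem adjInd_nonneg (u v : V) : 0 ≤ adjInd H u v := by unfold adjInd; split_ifs <;> norm_num

theorem adjInd_le_one (u v : V) : adjInd H u v ≤ 1 := by unfold adjInd; split_ifs <;> norm_num

/-- The cliques with `k` vertices that lie in the vertex set `B`. -/
noncomputable def cliquesIn (k : ℕ) (B : Finset V) : Finset (Finset V) :=
  open Classical in (B.powersetCard k).filter fun K => H.IsClique (K : Set V)

theorem mem_cliquesIn {k : ℕ} {B K : Finset V} :
    K ∈ cliquesIn H k B ↔ K ⊆ B ∧ K.card = k ∧ H.IsClique (K : Set V) := by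
  classical
  simp only [cliquesIn, Finset.mem_filter, Finset.mem_powersetCard, and_assoc]

-- A pair (z, K) determines a (k+1)-clique with a marked vertex z, and erasing the mark recovers K.
open Classical in
theorem sum_card_cliquesIn_le (k : ℕ) (B : Finset V) :
    ∑ z ∈ B, (cliquesIn H k (B.filter fun v => H.Adj z v)).card
      ≤ (cliquesIn H (k + 1) B).card * (k + 1) := by
  have e1 : (cliquesIn H (k + 1) B).card * (k + 1) =
      ((cliquesIn H (k + 1) B).sigma fun K => K).card := by
    rw [Finset.card_sigma, Finset.sum_const_nat]
    intro K hK
    exact ((mem_cliquesIn H).1 hK).2.1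
  rw [e1, ← Finset.card_sigma]
  have hnot : ∀ z K, K ∈ cliquesIn H k (B.filter fun v => H.Adj z v) → z ∉ K := by
    intro z K hK hz
    exact H.irrefl (Finset.mem_filter.1 (((mem_cliquesIn H).1 hK).1 hz)).2
  refine Finset.card_le_card_of_injOn (fun p => ⟨insert p.1 p.2, p.1⟩) ?_ ?_
  · rintro ⟨z, K⟩ hp
    simp only [Finset.coe_sigma, Set.mem_sigma_iff, Finset.mem_coe] at hp ⊢
    obtain ⟨hz, hK⟩ := hp
    have hzK := hnot z K hK
    rw [mem_cliquesIn] at hK ⊢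
    refine ⟨⟨?_, ?_, ?_⟩, Finset.mem_insert_self _ _⟩
    · exact Finset.insert_subset hz (hK.1.trans (Finset.filter_subset _ _))
    · rw [Finset.card_insert_of_notMem hzK, hK.2.1]
    · rw [Finset.coe_insert]
      exact hK.2.2.insert fun b hb _ => (Finset.mem_filter.1 (hK.1 hb)).2
  · rintro ⟨z, K⟩ hp ⟨z', K'⟩ hp' heq
    simp only [Finset.coe_sigma, Set.mem_sigma_iff, Finset.mem_coe] at hp hp'
    simp only [Sigma.mk.injEq] at heq
    obtain ⟨h1, h2⟩ := heq
    have hzz : z = z' := eq_of_heq h2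
    subst hzz
    have : K = K' := by
      rw [← Finset.erase_insert (hnot z K hp.2), h1, Finset.erase_insert (hnot z K' hp'.2)]
    subst this; rfl

variable [Fintype V]

/-- The sum of `f` over the neighbours of `u`. -/
noncomputable def nbrSum (f : V → ℝ) (u : V) : ℝ := ∑ v, adjInd H u v * f v

/-- The quadratic form of the adjacency matrix. -/
noncomputable def adjForm (f : V → ℝ) : ℝ := ∑ u, f u * nbrSum H f u

theorem adjForm_eq_sum (f : V → ℝ) : adjForm H f = ∑ u, ∑ v, adjInd H u v * (f u * f v) := by
  simp only [adjForm, nbrSum, Finset.mul_sum]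
  exact Finset.sum_congr rfl fun u _ => Finset.sum_congr rfl fun v _ => by ring

theorem sum_mul_nbrSum_comm (f g : V → ℝ) :
    ∑ u, f u * nbrSum H g u = ∑ u, g u * nbrSum H f u := by
  simp only [nbrSum, Finset.mul_sum]
  rw [Finset.sum_comm]
  refine Finset.sum_congr rfl fun u _ => Finset.sum_congr rfl fun v _ => ?_
  rw [adjInd_comm]; ring

theorem nbrSum_add (f g : V → ℝ) (u : V) :
    nbrSum H (f + g) u = nbrSum H f u + nbrSum H g u := by
  simp [nbrSum, mul_add, Finset.sum_add_distrib]

theorem nbrSum_nonneg {f : V → ℝ} (hf : ∀ v, 0 ≤ f v) (u : V) : 0 ≤ nbrSum H f u :=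
  Finset.sum_nonneg fun v _ => mul_nonneg (adjInd_nonneg H u v) (hf v)

theorem adjForm_nonneg {f : V → ℝ} (hf : ∀ v, 0 ≤ f v) : 0 ≤ adjForm H f :=
  Finset.sum_nonneg fun u _ => mul_nonneg (hf u) (nbrSum_nonneg H hf u)

theorem adjForm_add (f g : V → ℝ) :
    adjForm H (f + g) = adjForm H f + 2 * ∑ u, g u * nbrSum H f u + adjForm H g := by
  have h := sum_mul_nbrSum_comm H f g
  simp only [adjForm, nbrSum_add, Pi.add_apply, add_mul, mul_add, Finset.sum_add_distrib, h]
  ring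

theorem adjForm_add_single [DecidableEq V] (f : V → ℝ) (u : V) (c : ℝ) :
    adjForm H (f + Pi.single u c) = adjForm H f + 2 * c * nbrSum H f u := by
  have h1 : ∑ v, (Pi.single u c : V → ℝ) v * nbrSum H f v = c * nbrSum H f u := by
    rw [Finset.sum_eq_single u]
    · simp
    · intro v _ hv; simp [hv]
    · simp
  have h2 : adjForm H (Pi.single u c) = 0 := by
    rw [adjForm, Finset.sum_eq_single u]
    · rw [nbrSum, Finset.sum_eq_single u]
      · simp [adjInd_self]
      · intro v _ hv; simp [hv]
      · simp
    · intro v _ hv; simp [hv]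
    · simp
  rw [adjForm_add, h1, h2]; ring

theorem adjForm_smul (c : ℝ) (f : V → ℝ) : adjForm H (c • f) = c ^ 2 * adjForm H f := by
  simp only [adjForm_eq_sum, Pi.smul_apply, smul_eq_mul, Finset.mul_sum]
  exact Finset.sum_congr rfl fun u _ => Finset.sum_congr rfl fun v _ => by ring

theorem abs_adjForm_le (f : V → ℝ) : |adjForm H f| ≤ adjForm H fun v => |f v| := by
  rw [adjForm_eq_sum, adjForm_eq_sum]
  refine (Finset.abs_sum_le_sum_abs _ _).trans (Finset.sum_le_sum fun u _ =>
    (Finset.abs_sum_le_sum_abs _ _).trans (Finset.sum_le_sum fun v _ => ?_))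
  rw [abs_mul, abs_mul, abs_of_nonneg (adjInd_nonneg H u v)]

theorem adjForm_deleteEdge [DecidableEq V] (f : V → ℝ) {u v : V} (h : H.Adj u v) :
    adjForm (H.deleteEdges {s(u, v)}) f = adjForm H f - 2 * (f u * f v) := by
  have key : ∀ p q, adjInd (H.deleteEdges {s(u, v)}) p q * (f p * f q) =
      adjInd H p q * (f p * f q) - (if p = u then if q = v then f p * f q else 0 else 0)
        - (if p = v then if q = u then f p * f q else 0 else 0) := by
    intro p q
    have hne := h.ne
    have h' := h.symm
    by_cases hpq : H.Adj p q
    · by_cases h1 : p = u ∧ q = v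
      · obtain ⟨rfl, rfl⟩ := h1
        simp [adjInd, hne, hpq]
      · by_cases h2 : p = v ∧ q = u
        · obtain ⟨rfl, rfl⟩ := h2
          simp [adjInd, hne.symm, h', Sym2.eq_swap]
        · have : ¬ (s(p, q) = s(u, v)) := by
            rw [Sym2.eq_iff]; tauto
          have h3 : (if p = u then if q = v then f p * f q else 0 else 0) = 0 := by
            rw [← ite_and]; exact if_neg h1
          have h4 : (if p = v then if q = u then f p * f q else 0 else 0) = 0 := by
            rw [← ite_and]; exact if_neg h2
          rw [h3, h4]
          simp [adjInd, hpq, this]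
    · have h1 : ¬ (p = u ∧ q = v) := by rintro ⟨rfl, rfl⟩; exact hpq h
      have h2 : ¬ (p = v ∧ q = u) := by rintro ⟨rfl, rfl⟩; exact hpq h'
      rw [← ite_and, ← ite_and, if_neg h1, if_neg h2]
      simp [adjInd, hpq]
  rw [adjForm_eq_sum, adjForm_eq_sum]
  simp only [key, Finset.sum_sub_distrib]
  simp [Finset.sum_ite_eq', Finset.sum_ite_irrel]
  ring

/-- The weighted Turán (Motzkin–Straus) inequality. -/
theorem adjForm_le_of_no_clique {r : ℕ} (hr : 1 ≤ r) {μ : V → ℝ} (hμ : ∀ v, 0 ≤ μ v)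
    (h : ∀ K : Finset V, H.IsNClique (r + 1) K → ∃ v ∈ K, μ v = 0) :
    adjForm H μ ≤ (1 - 1 / (r : ℝ)) * (∑ v, μ v) ^ 2 := by
  classical
  induction r, hr using Nat.le_induction generalizing μ with
  | base =>
    have : adjForm H μ = 0 := by
      rw [adjForm_eq_sum]
      refine Finset.sum_eq_zero fun u _ => Finset.sum_eq_zero fun v _ => ?_
      by_cases huv : H.Adj u v
      · obtain ⟨w, hw, hw0⟩ := h {u, v} (by
          rw [SimpleGraph.isNClique_iff, Finset.card_pair huv.ne]
          simp [SimpleGraph.isClique_iff, huv])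
        simp only [Finset.mem_insert, Finset.mem_singleton] at hw
        rcases hw with rfl | rfl <;> simp [hw0]
      · simp [adjInd_of_not_adj H huv]
    simp [this]
  | succ r hr ih =>
    have hr0 : (0 : ℝ) < r := by exact_mod_cast hr
    by_cases hne : (Finset.univ.filter fun v => μ v ≠ 0).Nonempty
    · obtain ⟨u, hu, hmax⟩ := Finset.exists_max_image _ (nbrSum H μ) hne
      simp only [Finset.mem_filter, Finset.mem_univ, true_and] at hu hmax
      set D := nbrSum H μ u with hD
      set S := ∑ v, μ v with hS
      set ν : V → ℝ := fun v => adjInd H u v * μ v with hν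
      set ω : V → ℝ := fun v => (1 - adjInd H u v) * μ v with hω
      have hν0 : ∀ v, 0 ≤ ν v := fun v => mul_nonneg (adjInd_nonneg H u v) (hμ v)
      have hω0 : ∀ v, 0 ≤ ω v := fun v =>
        mul_nonneg (sub_nonneg.2 (adjInd_le_one H u v)) (hμ v)
      have hsum : μ = ν + ω := by funext v; simp [hν, hω]; ring
      have hSω : ∑ v, ω v = S - D := by
        simp [hω, hS, hD, nbrSum, sub_mul, Finset.sum_sub_distrib]
      have hνle := ih hν0 (by
        intro K hK
        by_contra! hcon
        have hadj : ∀ v ∈ K, H.Adj u v := fun v hv => by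
          by_contra hna
          exact hcon v hv (by simp [hν, adjInd_of_not_adj H hna])
        obtain ⟨w, hw, hw0⟩ := h (insert u K) (hK.insert hadj)
        rcases Finset.mem_insert.1 hw with rfl | hw
        · exact hu hw0
        · exact hcon w hw (by simp [hν, hw0]))
      have h1 : adjForm H μ = adjForm H ν + 2 * ∑ v, ω v * nbrSum H μ v - adjForm H ω := by
        have e1 : ∑ v, ω v * nbrSum H μ v = ∑ v, ω v * nbrSum H ν v + adjForm H ω := by
          rw [hsum]
          simp [nbrSum_add, mul_add, Finset.sum_add_distrib, adjForm]
        rw [e1]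
        conv_lhs => rw [hsum]
        rw [adjForm_add]; ring
      have h2 : ∑ v, ω v * nbrSum H μ v ≤ (S - D) * D := by
        rw [← hSω, Finset.sum_mul]
        refine Finset.sum_le_sum fun v _ => ?_
        by_cases hv : μ v = 0
        · simp [hω, hv]
        · exact mul_le_mul_of_nonneg_left (hmax v hv) (hω0 v)
      have h3 := adjForm_nonneg H hω0
      have h4 : ∑ v, ν v = D := rfl
      rw [h4] at hνle
      have h5 : adjForm H μ ≤ (1 - 1 / (r : ℝ)) * D ^ 2 + 2 * ((S - D) * D) := by linarith
      refine h5.trans ?_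
      have h6 : (1 - 1 / ((r + 1 : ℕ) : ℝ)) * S ^ 2
          - ((1 - 1 / (r : ℝ)) * D ^ 2 + 2 * ((S - D) * D))
          = (r * S - (r + 1) * D) ^ 2 / (r * (r + 1)) := by
        push_cast; field_simp; ring
      have : 0 ≤ (r * S - (r + 1) * D) ^ 2 / ((r : ℝ) * (r + 1)) := by positivity
      linarith
    · have hz : ∀ v, μ v = 0 := by
        intro v; by_contra hv; exact hne ⟨v, by simpa using hv⟩
      simp [adjForm, hz]

/-- Greedy counting of cliques inside a set of vertices. -/
theorem pow_le_factorial_mul_card_cliquesIn {μ : V → ℝ} (hμ : ∀ v, 0 ≤ μ v) {ρ κ β : ℝ}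
    (hρ : 0 ≤ ρ) (hκ : 0 < κ) (hβ : 0 ≤ β) (k : ℕ) (B : Finset V)
    (hB : ∀ z ∈ B, μ z ≤ κ ∧ ∑ v, (1 - adjInd H z v) * μ v ≤ ρ)
    (hsum : (k : ℝ) * ρ - ρ + β ≤ ∑ z ∈ B, μ z) :
    (β / κ) ^ k ≤ (k.factorial : ℝ) * ((cliquesIn H k B).card : ℝ) := by
  classical
  induction k generalizing B with
  | zero =>
    have : ∅ ∈ cliquesIn H 0 B := by simp [mem_cliquesIn]
    have := Finset.card_pos.2 ⟨_, this⟩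
    simpa using this
  | succ k ih =>
    -- Choosing z discards mass at most ρ from `B`, which is exactly what the hypothesis on the
    -- total mass loses when k + 1 drops to k.
    have hstep : ∀ z ∈ B, (β / κ) ^ k ≤
        (k.factorial : ℝ) * ((cliquesIn H k (B.filter fun v => H.Adj z v)).card : ℝ) := by
      intro z hz
      refine ih _ (fun w hw => hB w (Finset.mem_filter.1 hw).1) ?_
      have h1 := Finset.sum_filter_add_sum_filter_not B (fun v => H.Adj z v) μ
      have h2 : ∑ v ∈ B.filter (fun v => ¬ H.Adj z v), μ v ≤ ρ := by
        refine le_trans ?_ (hB z hz).2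
        calc ∑ v ∈ B.filter (fun v => ¬ H.Adj z v), μ v
            = ∑ v ∈ B.filter (fun v => ¬ H.Adj z v), (1 - adjInd H z v) * μ v := by
              refine Finset.sum_congr rfl fun v hv => ?_
              rw [adjInd_of_not_adj H (Finset.mem_filter.1 hv).2]; ring
          _ ≤ _ := Finset.sum_le_sum_of_subset_of_nonneg (Finset.subset_univ _)
              fun v _ _ => mul_nonneg (sub_nonneg.2 (adjInd_le_one H z v)) (hμ v)
      push_cast at hsum
      linarith
    have hcard : β / κ ≤ (B.card : ℝ) := by
      rw [div_le_iff₀ hκ]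
      have h1 : ∑ z ∈ B, μ z ≤ B.card • κ := Finset.sum_le_card_nsmul _ _ _ fun z hz => (hB z hz).1
      rw [nsmul_eq_mul] at h1
      have h2 : 0 ≤ (k : ℝ) * ρ := by positivity
      push_cast at hsum
      linarith
    have hdouble : ∑ z ∈ B, ((cliquesIn H k (B.filter fun v => H.Adj z v)).card : ℝ)
        ≤ ((cliquesIn H (k + 1) B).card : ℝ) * (k + 1) := by
      exact_mod_cast sum_card_cliquesIn_le H k B
    have hβκ : 0 ≤ (β / κ) ^ k := by positivity
    calc (β / κ) ^ (k + 1) = (β / κ) * (β / κ) ^ k := by ring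
      _ ≤ B.card * (β / κ) ^ k := mul_le_mul_of_nonneg_right hcard hβκ
      _ = ∑ z ∈ B, (β / κ) ^ k := by simp
      _ ≤ ∑ z ∈ B, (k.factorial : ℝ) *
            ((cliquesIn H k (B.filter fun v => H.Adj z v)).card : ℝ) :=
          Finset.sum_le_sum hstep
      _ = k.factorial * ∑ z ∈ B, ((cliquesIn H k (B.filter fun v => H.Adj z v)).card : ℝ) := by
          rw [Finset.mul_sum]
      _ ≤ k.factorial * (((cliquesIn H (k + 1) B).card : ℝ) * (k + 1)) := by gcongr
      _ = ((k + 1).factorial : ℝ) * ((cliquesIn H (k + 1) B).card : ℝ) := by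
          rw [Nat.factorial_succ]; push_cast; ring

end AdjForm

/-! ### The extremal weighted subgraph and its optimality conditions. -/

section Extremal

variable {V : Type*} [Fintype V]

/-- A vertex scaling `s` with values in `[0, 1]` and a nonnegative unit vector `x`. -/
structure IsFeasible (s x : V → ℝ) : Prop where
  s_nonneg : ∀ v, 0 ≤ s v
  s_le_one : ∀ v, s v ≤ 1
  x_nonneg : ∀ v, 0 ≤ x v
  sum_sq : ∑ v, x v ^ 2 = 1

/-- The squared quadratic form of the scaled graph minus `a` times its total edge weight. -/
noncomputable def excess (a : ℝ) (H : SimpleGraph V) (s x : V → ℝ) : ℝ :=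
  adjForm H (s * x) ^ 2 - a * adjForm H (s ^ 2)

/-- `H`, `s`, `x` maximise the excess among all subgraphs of `G`, scalings and unit vectors. -/
structure IsExtremal (G : SimpleGraph V) (a : ℝ) (H : SimpleGraph V) (s x : V → ℝ) : Prop where
  le : H ≤ G
  feasible : IsFeasible s x
  maximal : ∀ H' ≤ G, ∀ s' x', IsFeasible s' x' → excess a H' s' x' ≤ excess a H s x

theorem isCompact_isFeasible :
    IsCompact {p : (V → ℝ) × (V → ℝ) | IsFeasible p.1 p.2} := by
  have hsub : {p : (V → ℝ) × (V → ℝ) | IsFeasible p.1 p.2} ⊆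
      Set.Icc (0 : V → ℝ) 1 ×ˢ Set.Icc (0 : V → ℝ) 1 := by
    rintro ⟨s, x⟩ h
    refine ⟨⟨h.s_nonneg, h.s_le_one⟩, h.x_nonneg, fun v => ?_⟩
    have h1 : x v ^ 2 ≤ 1 := by
      have := h.sum_sq
      simp only at this
      rw [← this]
      exact Finset.single_le_sum (f := fun v => x v ^ 2) (fun w _ => sq_nonneg _)
        (Finset.mem_univ v)
    exact (abs_le_one_iff_mul_self_le_one.2 (by nlinarith) |> (le_abs_self _).trans)
  refine IsCompact.of_isClosed_subset (isCompact_Icc.prod isCompact_Icc) ?_ hsub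
  have : {p : (V → ℝ) × (V → ℝ) | IsFeasible p.1 p.2} =
      {p | 0 ≤ p.1} ∩ {p | p.1 ≤ 1} ∩ {p | 0 ≤ p.2} ∩ {p | ∑ v, p.2 v ^ 2 = 1} := by
    ext p
    exact ⟨fun h => ⟨⟨⟨h.s_nonneg, h.s_le_one⟩, h.x_nonneg⟩, h.sum_sq⟩,
      fun h => ⟨h.1.1.1, h.1.1.2, h.1.2, h.2⟩⟩
  rw [this]
  refine ((IsClosed.inter ?_ ?_).inter ?_).inter ?_
  · exact isClosed_le continuous_const continuous_fst
  · exact isClosed_le continuous_fst continuous_const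
  · exact isClosed_le continuous_const continuous_snd
  · exact isClosed_eq (by fun_prop) continuous_const

theorem continuous_excess (a : ℝ) (H : SimpleGraph V) :
    Continuous fun p : (V → ℝ) × (V → ℝ) => excess a H p.1 p.2 := by
  simp only [excess, adjForm_eq_sum, Pi.mul_apply, Pi.pow_apply]
  fun_prop

/-- There are finitely many subgraphs, and for each one a continuous function is maximised on a
compact set. -/
theorem exists_isExtremal (G : SimpleGraph V) (a : ℝ) {s₀ x₀ : V → ℝ} (h₀ : IsFeasible s₀ x₀) :
    ∃ H s x, IsExtremal G a H s x := by
  have hne : {p : (V → ℝ) × (V → ℝ) | IsFeasible p.1 p.2}.Nonempty := ⟨(s₀, x₀), h₀⟩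
  choose p hp hmax using fun H : SimpleGraph V =>
    isCompact_isFeasible.exists_isMaxOn hne (continuous_excess a H).continuousOn
  have : Nonempty {H : SimpleGraph V // H ≤ G} := ⟨⟨G, le_rfl⟩⟩
  obtain ⟨⟨H, hH⟩, hHmax⟩ := Finite.exists_max
    fun H : {H : SimpleGraph V // H ≤ G} => excess a H.1 (p H.1).1 (p H.1).2
  refine ⟨H, (p H).1, (p H).2, hH, hp H, fun H' hH' s' x' h' => ?_⟩
  exact (hmax H' (show (s', x') ∈ _ from h')).trans (hHmax ⟨H', hH'⟩)

namespace IsExtremal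

variable {G H : SimpleGraph V} {a : ℝ} {s x : V → ℝ}

theorem adjForm_nonneg (h : IsExtremal G a H s x) : 0 ≤ adjForm H (s * x) :=
  _root_.adjForm_nonneg H fun v => mul_nonneg (h.feasible.s_nonneg v) (h.feasible.x_nonneg v)

/-- With H and s fixed only the form at sx varies, so x maximises a Rayleigh quotient. Absolute
values and normalisation reduce an arbitrary y to a feasible one. -/
theorem adjForm_mul_le (h : IsExtremal G a H s x) (y : V → ℝ) :
    adjForm H (s * y) ≤ adjForm H (s * x) * ∑ v, y v ^ 2 := by
  set N := ∑ v, y v ^ 2 with hN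
  have hN0 : 0 ≤ N := Finset.sum_nonneg fun v _ => sq_nonneg _
  rcases hN0.eq_or_lt with h0 | hpos
  · have hy : y = 0 := by
      funext v
      have := (Finset.sum_eq_zero_iff_of_nonneg fun v _ => sq_nonneg (y v)).1 h0.symm v
        (Finset.mem_univ v)
      simpa using this
    rw [← h0, hy]
    simp [adjForm]
  · set y' : V → ℝ := fun v => |y v| / √N with hy'
    have hsq : √N ^ 2 = N := Real.sq_sqrt hN0
    have hfeas : IsFeasible s y' := by
      refine ⟨h.feasible.s_nonneg, h.feasible.s_le_one, fun v => by positivity, ?_⟩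
      simp only [hy', div_pow, hsq, sq_abs, ← Finset.sum_div]
      exact div_self hpos.ne'
    have h1 := h.maximal H h.le s y' hfeas
    have h2 : adjForm H (s * y') ≤ adjForm H (s * x) := by
      refine abs_le_of_sq_le_sq' ?_ h.adjForm_nonneg |>.2
      simpa [excess] using h1
    have h3 : (fun v => |(s * y) v|) = √N • (s * y') := by
      funext v
      have : √N ≠ 0 := (Real.sqrt_pos.2 hpos).ne'
      simp only [Pi.mul_apply, abs_mul, abs_of_nonneg (h.feasible.s_nonneg v), Pi.smul_apply,
        smul_eq_mul, hy']
      field_simp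
    calc adjForm H (s * y) ≤ adjForm H fun v => |(s * y) v| :=
          (le_abs_self _).trans (abs_adjForm_le H _)
      _ = N * adjForm H (s * y') := by rw [h3, adjForm_smul, hsq]
      _ ≤ N * adjForm H (s * x) := mul_le_mul_of_nonneg_left h2 hN0
      _ = _ := mul_comm _ _

theorem eigen (h : IsExtremal G a H s x) (hpos : 0 < adjForm H (s * x)) (u : V) :
    adjForm H (s * x) * x u = s u * nbrSum H (s * x) u := by
  classical
  set l := adjForm H (s * x) with hl
  set A := s u * nbrSum H (s * x) u - l * x u with hA
  have key : ∀ t : ℝ, 2 * t * A ≤ l * t ^ 2 := by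
    intro t
    have h1 := h.adjForm_mul_le (x + Pi.single u t : V → ℝ)
    have h2 : s * (x + Pi.single u t : V → ℝ) = s * x + Pi.single u (s u * t) := by
      rw [mul_add]
      congr 1
      funext v
      by_cases hv : v = u
      · subst hv; simp
      · simp [hv]
    have h3 : ∑ v, (x + Pi.single u t : V → ℝ) v ^ 2 = 1 + 2 * t * x u + t ^ 2 := by
      have : ∀ v, (x + Pi.single u t : V → ℝ) v ^ 2 =
          x v ^ 2 + if v = u then 2 * t * x u + t ^ 2 else 0 := by
        intro v
        by_cases hv : v = u
        · subst hv; simp; ring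
        · simp [hv]
      simp only [this, Finset.sum_add_distrib, h.feasible.sum_sq]
      simp
      ring
    rw [h2, h3, adjForm_add_single, ← hl] at h1
    rw [hA]
    linarith
  -- This t maximises 2tA - lt², and the maximum A²/l is positive unless A = 0.
  have h1 := key (A / l)
  have h2 : 2 * (A / l) * A = 2 * (A ^ 2 / l) := by ring
  have h3 : l * (A / l) ^ 2 = A ^ 2 / l := by field_simp
  rw [h2, h3] at h1
  have h4 : A ^ 2 / l ≤ 0 := by linarith
  have h5 : A ^ 2 ≤ 0 := by
    by_contra hcon
    push Not at hcon
    have := div_pos hcon hpos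
    linarith
  have h6 : A = 0 := by nlinarith
  rw [hA] at h6
  linarith

theorem scale_pos_of_ne_zero (h : IsExtremal G a H s x) (hpos : 0 < adjForm H (s * x)) {u : V}
    (hu : x u ≠ 0) : 0 < s u := by
  refine lt_of_le_of_ne (h.feasible.s_nonneg u) fun h0 => ?_
  have := h.eigen hpos u
  rw [← h0, zero_mul] at this
  exact (mul_ne_zero hpos.ne' hu) this

/-- Replacing s u by (1 - t) s u cannot raise the excess. To first order the squared form loses
4tl²(x u)² and the edge penalty drops by 4taW, with W as in the proof. -/
theorem mul_nbrSum_le (h : IsExtremal G a H s x) (hpos : 0 < adjForm H (s * x))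
    (u : V) : a * (s u ^ 2 * nbrSum H (s ^ 2) u) ≤ adjForm H (s * x) ^ 2 * x u ^ 2 := by
  classical
  have heig := h.eigen hpos u
  set l := adjForm H (s * x) with hl
  set W := s u ^ 2 * nbrSum H (s ^ 2) u with hW
  have key : ∀ t : ℝ, 0 ≤ t → t ≤ 1 → (l - 2 * t * l * x u ^ 2) ^ 2 + 2 * a * (2 * t - t ^ 2) * W
      ≤ l ^ 2 := by
    intro t ht0 ht1
    have hfeas : IsFeasible (s + Pi.single u (-(t * s u)) : V → ℝ) x := by
      have hs := h.feasible.s_nonneg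
      refine ⟨fun v => ?_, fun v => ?_, h.feasible.x_nonneg, h.feasible.sum_sq⟩
      · by_cases hv : v = u
        · subst hv
          simp only [Pi.add_apply, Pi.single_eq_same]
          nlinarith [hs v]
        · simpa [hv] using hs v
      · refine le_trans ?_ (h.feasible.s_le_one v)
        by_cases hv : v = u
        · subst hv
          simp only [Pi.add_apply, Pi.single_eq_same]
          nlinarith [hs v]
        · simp [hv]
    have h1 := h.maximal H h.le _ _ hfeas
    have h2 : (s + Pi.single u (-(t * s u)) : V → ℝ) * x
        = s * x + (Pi.single u (-(t * s u * x u)) : V → ℝ) := by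
      rw [add_mul]
      congr 1
      funext v
      by_cases hv : v = u
      · subst hv; simp
      · simp [hv]
    have h3 : (s + Pi.single u (-(t * s u)) : V → ℝ) ^ 2
        = s ^ 2 + (Pi.single u (((1 - t) ^ 2 - 1) * s u ^ 2) : V → ℝ) := by
      funext v
      by_cases hv : v = u
      · subst hv; simp; ring
      · simp [hv]
    rw [excess, excess, h2, h3, adjForm_add_single, adjForm_add_single, ← hl] at h1
    have h4 : l + 2 * -(t * s u * x u) * nbrSum H (s * x) u = l - 2 * t * l * x u ^ 2 := by
      linear_combination (2 * t * x u) * heig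
    rw [h4] at h1
    rw [hW]
    nlinarith [h1]
  by_contra hcon
  push Not at hcon
  have hX : 0 ≤ l ^ 2 * x u ^ 2 := by positivity
  have haW : 0 < a * W := lt_of_le_of_lt hX hcon
  set D := a * W - l ^ 2 * x u ^ 2 with hD
  have hD0 : 0 < D := by rw [hD]; linarith
  -- Small enough that the quadratic term -2t²aW consumes only half of the linear gain 4tD.
  set t := D / (a * W) with ht
  have ht0 : 0 < t := div_pos hD0 haW
  have ht1 : t ≤ 1 := by rw [ht, div_le_one haW]; linarith
  have htW : t * (a * W) = D := div_mul_cancel₀ _ haW.ne'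
  have h1 := key t ht0.le ht1
  have h2 : t * (4 * D - 2 * D) ≤ 0 := by
    have : (l - 2 * t * l * x u ^ 2) ^ 2 + 2 * a * (2 * t - t ^ 2) * W - l ^ 2
      = t * (4 * D - 2 * (t * (a * W))) + 4 * t ^ 2 * l ^ 2 * x u ^ 4 := by rw [hD]; ring
    rw [htW] at this
    have h5 : 0 ≤ 4 * t ^ 2 * l ^ 2 * x u ^ 4 := by positivity
    linarith
  nlinarith

/-- Deleting uv cannot raise the excess: the edge's contribution to l must pay for its weight in M.
-/
theorem edge_le (h : IsExtremal G a H s x) {u v : V} (huv : H.Adj u v) (hu : 0 < s u)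
    (hv : 0 < s v) : a * (s u * s v) ≤ 2 * adjForm H (s * x) * (x u * x v) := by
  classical
  have hle : H.deleteEdges {s(u, v)} ≤ G := (SimpleGraph.deleteEdges_le _).trans h.le
  have h1 := h.maximal _ hle s x h.feasible
  rw [excess, excess, adjForm_deleteEdge H _ huv, adjForm_deleteEdge H _ huv] at h1
  simp only [Pi.mul_apply, Pi.pow_apply] at h1
  have h2 : 0 < s u * s v := mul_pos hu hv
  set l := adjForm H (s * x)
  have h3 : (s u * s v) * (a * (s u * s v)) ≤ (s u * s v) * (2 * l * (x u * x v)) := by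
    nlinarith [sq_nonneg (s u * x u * (s v * x v))]
  exact le_of_mul_le_mul_left h3 h2

theorem sq_le_nbrSum (h : IsExtremal G a H s x) (u : V) :
    nbrSum H (s * x) u ^ 2 ≤ nbrSum H (s ^ 2) u := by
  have h1 : nbrSum H (s * x) u = ∑ v, (adjInd H u v * s v) * x v := by
    simp [nbrSum, mul_assoc]
  rw [h1]
  refine (Finset.sum_mul_sq_le_sq_mul_sq _ _ _).trans ?_
  rw [h.feasible.sum_sq, mul_one]
  refine Finset.sum_le_sum fun v _ => ?_
  rw [mul_pow, Pi.pow_apply]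
  refine mul_le_mul_of_nonneg_right ?_ (sq_nonneg _)
  exact pow_le_of_le_one (adjInd_nonneg H u v) (adjInd_le_one H u v) two_ne_zero

/-- One end of every edge has large weighted degree. -/
theorem le_max_nbrSum (h : IsExtremal G a H s x) (hpos : 0 < adjForm H (s * x))
    {u v : V} (huv : H.Adj u v) (hu : 0 < s u) (hv : 0 < s v) :
    a * adjForm H (s * x) / 2 ≤ max (nbrSum H (s ^ 2) u) (nbrSum H (s ^ 2) v) := by
  have e1 := h.eigen hpos u
  have e2 := h.eigen hpos v
  have e3 := h.edge_le huv hu hv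
  have q1 := h.sq_le_nbrSum u
  have q2 := h.sq_le_nbrSum v
  have n0 : ∀ w, 0 ≤ (s * x) w := fun w =>
    mul_nonneg (h.feasible.s_nonneg w) (h.feasible.x_nonneg w)
  have p1 := nbrSum_nonneg H n0 u
  have p2 := nbrSum_nonneg H n0 v
  set l := adjForm H (s * x)
  set g := nbrSum H (s * x) u
  set g' := nbrSum H (s * x) v
  set M := max (nbrSum H (s ^ 2) u) (nbrSum H (s ^ 2) v)
  have hM1 : g ^ 2 ≤ M := q1.trans (le_max_left _ _)
  have hM2 : g' ^ 2 ≤ M := q2.trans (le_max_right _ _)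
  -- The edge condition times l, rewritten by the eigenvalue equations, becomes al ≤ 2gg'.
  have hgg : g * g' ≤ M := by nlinarith [sq_nonneg (g - g')]
  have hss : 0 < s u * s v := mul_pos hu hv
  have h1 : (s u * s v) * (a * l) ≤ (s u * s v) * (2 * M) := by
    calc (s u * s v) * (a * l) = (a * (s u * s v)) * l := by ring
      _ ≤ (2 * l * (x u * x v)) * l := mul_le_mul_of_nonneg_right e3 hpos.le
      _ = 2 * ((l * x u) * (l * x v)) := by ring
      _ = (s u * s v) * (2 * (g * g')) := by rw [e1, e2]; ring
      _ ≤ (s u * s v) * (2 * M) := mul_le_mul_of_nonneg_left (by linarith) hss.le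
  have := le_of_mul_le_mul_left h1 hss
  linarith

/-- The support of the extremal vector contains a clique on `r + 1` vertices. -/
theorem exists_clique (h : IsExtremal G a H s x) {r : ℕ} (hr : 1 ≤ r)
    (hlarge : (1 - 1 / (r : ℝ)) * adjForm H (s ^ 2) < adjForm H (s * x) ^ 2) :
    ∃ K : Finset V, H.IsNClique (r + 1) K ∧ ∀ v ∈ K, x v ≠ 0 := by
  by_contra! hcon
  have h1 := adjForm_le_of_no_clique H hr (μ := x ^ 2) (fun v => sq_nonneg (x v)) (by
    intro K hK
    obtain ⟨v, hv, hv0⟩ := hcon K hK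
    exact ⟨v, hv, by simp [hv0]⟩)
  have h2 : ∑ v, (x ^ 2) v = 1 := h.feasible.sum_sq
  rw [h2, one_pow, mul_one] at h1
  -- Cauchy–Schwarz over ordered adjacent pairs. The Turán bound on the last factor then contradicts
  -- `hlarge`.
  have h3 : adjForm H (s * x) ^ 2 ≤ adjForm H (s ^ 2) * adjForm H (x ^ 2) := by
    simp only [adjForm_eq_sum, ← Finset.sum_product']
    refine Finset.sum_sq_le_sum_mul_sum_of_sq_le_mul _ ?_ ?_ ?_
    · intro p _
      exact mul_nonneg (adjInd_nonneg H _ _) (mul_nonneg (sq_nonneg _) (sq_nonneg _))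
    · intro p _
      exact mul_nonneg (adjInd_nonneg H _ _) (mul_nonneg (sq_nonneg _) (sq_nonneg _))
    · intro p _
      simp only [Pi.mul_apply, Pi.pow_apply]
      exact le_of_eq (by ring)
  have h4 : 0 ≤ adjForm H (s ^ 2) := _root_.adjForm_nonneg H fun v => sq_nonneg (s v)
  have h5 := mul_le_mul_of_nonneg_left h1 h4
  linarith

end IsExtremal

end Extremal

/-! ### Light neighbourhoods, and two of them with a large intersection. -/

section LightNeighbors

variable {V : Type*} [Fintype V]

/-- The neighbours `v` of `u` at which `x v / s v` is at most `τ` divided by the square root of the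
weighted degree of `u`. -/
noncomputable def lightNbrs (H : SimpleGraph V) (s x : V → ℝ) (τ : ℝ) (u : V) : Finset V :=
  @Finset.filter V
    (fun v => H.Adj u v ∧ 0 < s v ∧ x v ^ 2 * nbrSum H (s ^ 2) u ≤ τ ^ 2 * s v ^ 2)
    (Classical.decPred _) Finset.univ

theorem mem_lightNbrs {H : SimpleGraph V} {s x : V → ℝ} {τ : ℝ} {u v : V} :
    v ∈ lightNbrs H s x τ u ↔
      H.Adj u v ∧ 0 < s v ∧ x v ^ 2 * nbrSum H (s ^ 2) u ≤ τ ^ 2 * s v ^ 2 := by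
  simp [lightNbrs]

theorem nbrSum_pos_of_adj {H : SimpleGraph V} {s : V → ℝ} {u v : V} (huv : H.Adj u v)
    (hv : 0 < s v) : 0 < nbrSum H (s ^ 2) u := by
  refine Finset.sum_pos' (fun w _ => mul_nonneg (adjInd_nonneg H u w) (sq_nonneg _))
    ⟨v, Finset.mem_univ v, ?_⟩
  rw [adjInd_of_adj H huv, one_mul]
  exact pow_pos hv 2

namespace IsExtremal

variable {G H : SimpleGraph V} {a : ℝ} {s x : V → ℝ}

/-- Light neighbours carry nearly an `a` fraction of the mass. -/
theorem sub_le_sum_lightNbrs (h : IsExtremal G a H s x) (ha : 0 < a) (ha1 : a ≤ 1)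
    (hpos : 0 < adjForm H (s * x)) {τ : ℝ} (hτ : 0 < τ) {u : V} (hu : 0 < s u)
    (hd : 0 < nbrSum H (s ^ 2) u) :
    a - 2 / τ ≤ ∑ v ∈ lightNbrs H s x τ u, x v ^ 2 := by
  classical
  set L := lightNbrs H s x τ u with hL
  set d := nbrSum H (s ^ 2) u with hdd
  set m := ∑ v ∈ L, x v ^ 2 with hm
  set g := nbrSum H (s * x) u with hg
  have hs := h.feasible.s_nonneg
  have hx := h.feasible.x_nonneg
  have hm0 : 0 ≤ m := Finset.sum_nonneg fun v _ => sq_nonneg _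
  have hg0 : 0 ≤ g := nbrSum_nonneg H (fun v => mul_nonneg (hs v) (hx v)) u
  have hga : a * d ≤ g ^ 2 := by
    have h1 := h.mul_nbrSum_le hpos u
    have h2 := h.eigen hpos u
    have h3 : s u ^ 2 * (a * d) ≤ s u ^ 2 * g ^ 2 := by
      calc s u ^ 2 * (a * d) = a * (s u ^ 2 * d) := by ring
        _ ≤ adjForm H (s * x) ^ 2 * x u ^ 2 := h1
        _ = (adjForm H (s * x) * x u) ^ 2 := by ring
        _ = s u ^ 2 * g ^ 2 := by rw [h2]; ring
    exact le_of_mul_le_mul_left h3 (by positivity)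
  have hsd : 0 < √d := Real.sqrt_pos.2 hd
  have hsd2 : √d ^ 2 = d := Real.sq_sqrt hd.le
  have hlight : ∑ v ∈ L, s v * x v ≤ √d * √m := by
    refine (Real.sum_mul_le_sqrt_mul_sqrt _ _ _).trans ?_
    refine mul_le_mul_of_nonneg_right (Real.sqrt_le_sqrt ?_) (Real.sqrt_nonneg _)
    calc ∑ v ∈ L, s v ^ 2 = ∑ v ∈ L, adjInd H u v * (s ^ 2) v := by
          refine Finset.sum_congr rfl fun v hv => ?_
          rw [adjInd_of_adj H (mem_lightNbrs.1 hv).1, one_mul, Pi.pow_apply]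
      _ ≤ d := Finset.sum_le_sum_of_subset_of_nonneg (Finset.subset_univ _)
          fun v _ _ => mul_nonneg (adjInd_nonneg H u v) (sq_nonneg _)
  -- A heavy neighbour has s v < x v √d / τ, so the heavy part of g is at most √d/τ. With `hga` and
  -- `hlight` this gives √a ≤ √m + 1/τ.
  have hheavy : ∀ v, v ∉ L → adjInd H u v * (s * x) v ≤ √d / τ * x v ^ 2 := by
    intro v hv
    have hr : 0 ≤ √d / τ * x v ^ 2 := by positivity
    by_cases huv : H.Adj u v
    · rcases (hs v).eq_or_lt with h0 | h0
      · simpa [← h0] using hr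
      · have h1 : τ ^ 2 * s v ^ 2 < x v ^ 2 * d := by
          by_contra hcon
          exact hv (mem_lightNbrs.2 ⟨huv, h0, not_lt.1 hcon⟩)
        have h2 : τ * s v ≤ x v * √d := by
          refine abs_le_of_sq_le_sq' ?_ (mul_nonneg (hx v) hsd.le) |>.2
          rw [mul_pow, mul_pow, hsd2]; exact h1.le
        rw [adjInd_of_adj H huv, one_mul, Pi.mul_apply, div_mul_eq_mul_div, le_div_iff₀ hτ]
        nlinarith [mul_le_mul_of_nonneg_right h2 (hx v)]
    · simpa [adjInd_of_not_adj H huv] using hr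
  have hgle : g ≤ √d * (√m + 1 / τ) := by
    have h1 : g = ∑ v ∈ L, adjInd H u v * (s * x) v
        + ∑ v ∈ Finset.univ.filter (· ∉ L), adjInd H u v * (s * x) v := by
      have := Finset.sum_filter_add_sum_filter_not Finset.univ (fun v => v ∈ L)
        (fun v => adjInd H u v * (s * x) v)
      rw [Finset.filter_mem_eq_inter, Finset.univ_inter] at this
      exact this.symm
    have h2 : ∑ v ∈ L, adjInd H u v * (s * x) v = ∑ v ∈ L, s v * x v :=
      Finset.sum_congr rfl fun v hv => by
        rw [adjInd_of_adj H (mem_lightNbrs.1 hv).1, one_mul, Pi.mul_apply]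
    have h3 : ∑ v ∈ Finset.univ.filter (· ∉ L), adjInd H u v * (s * x) v ≤ √d / τ := by
      calc _ ≤ ∑ v ∈ Finset.univ.filter (· ∉ L), √d / τ * x v ^ 2 :=
            Finset.sum_le_sum fun v hv => hheavy v (Finset.mem_filter.1 hv).2
        _ ≤ ∑ v, √d / τ * x v ^ 2 := Finset.sum_le_sum_of_subset_of_nonneg
            (Finset.subset_univ _) fun v _ _ => by positivity
        _ = √d / τ := by rw [← Finset.mul_sum, h.feasible.sum_sq, mul_one]
    rw [h1, h2]
    calc _ ≤ √d * √m + √d / τ := add_le_add hlight h3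
      _ = _ := by ring
  have hsm : 0 ≤ √m := Real.sqrt_nonneg _
  have hτ1 : 0 < 1 / τ := by positivity
  have h1 : a ≤ (√m + 1 / τ) ^ 2 := by
    have : d * a ≤ d * (√m + 1 / τ) ^ 2 := by
      calc d * a = a * d := by ring
        _ ≤ g ^ 2 := hga
        _ ≤ (√d * (√m + 1 / τ)) ^ 2 := pow_le_pow_left₀ hg0 hgle 2
        _ = d * (√m + 1 / τ) ^ 2 := by rw [mul_pow, hsd2]
    exact le_of_mul_le_mul_left this hd
  have hsa : 0 ≤ √a := Real.sqrt_nonneg _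
  have hsa2 : √a ^ 2 = a := Real.sq_sqrt ha.le
  have hsa1 : √a ≤ 1 := Real.sqrt_le_one.2 ha1
  have h2 : √a ≤ √m + 1 / τ := by
    refine abs_le_of_sq_le_sq' ?_ (by positivity) |>.2
    rw [hsa2]; exact h1
  have hsm2 : √m ^ 2 = m := Real.sq_sqrt hm0
  have h3 : a - 2 * (1 / τ) ≤ m := by
    rcases le_total (√a) (1 / τ) with hc | hc
    · nlinarith
    · nlinarith
  have : 2 / τ = 2 * (1 / τ) := by ring
  rw [this]; exact h3

end IsExtremal

/-- If the sets `L q` are large, then some two of them have a large intersection; quantified over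
the members of a finite family. -/
theorem exists_pair_sum_inter_ge [DecidableEq V] {μ : V → ℝ} (hμ : ∀ v, 0 ≤ μ v)
    (hμ1 : ∑ v, μ v = 1) {r : ℕ} (hr : 1 ≤ r) (K : Finset V) (hK : K.card = r + 1)
    (L : V → Finset V) {δ η : ℝ}
    (hη : (r + 1 : ℝ) * (η + δ) + (r + 1) * r / 2 * (η + 2 * δ) < 1 / r)
    (hL : ∀ q ∈ K, 1 - 1 / (r : ℝ) - δ ≤ ∑ v ∈ L q, μ v) :
    ∃ p ∈ K, ∃ q ∈ K, p ≠ q ∧ 1 - 2 / (r : ℝ) + η ≤ ∑ v ∈ L p ∩ L q, μ v := by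
  by_contra! hcon
  have hr0 : (0 : ℝ) < r := by exact_mod_cast hr
  set M : Finset V → ℝ := fun A => ∑ v ∈ A, μ v with hM
  have hM1 : ∀ A, M A ≤ 1 := fun A => by
    rw [← hμ1]
    exact Finset.sum_le_sum_of_subset_of_nonneg (Finset.subset_univ _) fun v _ _ => hμ v
  have hunion : ∀ A B, M (A ∪ B) + M (A ∩ B) = M A + M B := fun A B =>
    Finset.sum_union_inter
  have hcompl : ∀ A, M A + M Aᶜ = 1 := fun A => by
    rw [← hμ1]; exact Finset.sum_add_sum_compl A μ
  have hinter : ∀ p ∈ K, ∀ q ∈ K, p ≠ q → M ((L p)ᶜ ∩ (L q)ᶜ) ≤ η + 2 * δ := by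
    intro p hp q hq hpq
    have h1 := hunion (L p) (L q)
    have h2 := hcompl (L p ∪ L q)
    rw [Finset.compl_union] at h2
    have h3 := hcon p hp q hq hpq
    have h4 := hL p hp
    have h5 := hL q hq
    have h6 : 2 / (r : ℝ) = 2 * (1 / r) := by ring
    change M (L p ∩ L q) < _ at h3
    change _ ≤ M (L p) at h4
    change _ ≤ M (L q) at h5
    linarith
  have hlow : ∀ p ∈ K, 1 / (r : ℝ) - η - δ ≤ M (L p)ᶜ := by
    intro p hp
    obtain ⟨q, hq, hqp⟩ := Finset.exists_mem_ne (by omega : 1 < K.card) p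
    have h1 := hunion (L p) (L q)
    have h2 := hM1 (L p ∪ L q)
    have h3 := hcon p hp q hq hqp.symm
    have h5 := hL q hq
    have h6 := hcompl (L p)
    have h7 : 2 / (r : ℝ) = 2 * (1 / r) := by ring
    change M (L p ∩ L q) < _ at h3
    change _ ≤ M (L q) at h5
    linarith
  -- Bonferroni's inequality in integrated form: a vertex lying in k complements satisfies 3k ≤ k² +
  -- 2. The r + 1 complements, each of mass about 1/r, are too heavy to be nearly disjoint.
  have hpoint : 3 * ∑ p ∈ K, M (L p)ᶜ ≤ 2 + ∑ p ∈ K, ∑ q ∈ K, M ((L p)ᶜ ∩ (L q)ᶜ) := by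
    have e : ∀ A, M A = ∑ v, (if v ∈ A then 1 else 0) * μ v := fun A => by
      simp [hM, Finset.sum_ite_mem]
    have e1 : ∑ p ∈ K, M (L p)ᶜ = ∑ v, (∑ p ∈ K, if v ∈ (L p)ᶜ then (1 : ℝ) else 0) * μ v := by
      simp only [e, Finset.sum_mul]
      rw [Finset.sum_comm]
    have e2 : ∑ p ∈ K, ∑ q ∈ K, M ((L p)ᶜ ∩ (L q)ᶜ)
        = ∑ v, (∑ p ∈ K, if v ∈ (L p)ᶜ then (1 : ℝ) else 0) ^ 2 * μ v := by
      have h1 : ∀ p q, M ((L p)ᶜ ∩ (L q)ᶜ) =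
          ∑ v, ((if v ∈ (L p)ᶜ then (1 : ℝ) else 0) * if v ∈ (L q)ᶜ then 1 else 0) * μ v := by
        intro p q
        rw [e]
        refine Finset.sum_congr rfl fun v _ => ?_
        by_cases hp : v ∈ L p <;> by_cases hq : v ∈ L q <;> simp [hp, hq]
      simp only [h1, sq, Finset.sum_mul_sum]
      simp only [Finset.sum_mul]
      rw [Finset.sum_comm (s := Finset.univ)]
      exact Finset.sum_congr rfl fun p _ => Finset.sum_comm
    have e3 : (2 : ℝ) = ∑ v, 2 * μ v := by rw [← Finset.mul_sum, hμ1, mul_one]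
    rw [e1, e2, e3, Finset.mul_sum, ← Finset.sum_add_distrib]
    refine Finset.sum_le_sum fun v _ => ?_
    have hcast : (∑ p ∈ K, if v ∈ (L p)ᶜ then (1 : ℝ) else 0)
        = ((K.filter fun p => v ∈ (L p)ᶜ).card : ℝ) := by rw [Finset.sum_boole]
    rw [hcast]
    set k := (K.filter fun p => v ∈ (L p)ᶜ).card
    have hk : (0 : ℝ) ≤ ((k : ℝ) - 1) * (k - 2) := by
      rcases Nat.lt_or_ge k 2 with hk | hk
      · interval_cases k <;> norm_num
      · have : (2 : ℝ) ≤ k := by exact_mod_cast hk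
        exact mul_nonneg (by linarith) (by linarith)
    nlinarith [hμ v, mul_nonneg hk (hμ v)]
  have hinner : ∀ p ∈ K, ∑ q ∈ K, M ((L p)ᶜ ∩ (L q)ᶜ) ≤ M (L p)ᶜ + r * (η + 2 * δ) := by
    intro p hp
    rw [← Finset.add_sum_erase K _ hp, Finset.inter_self]
    refine add_le_add_right ?_ _
    calc _ ≤ (K.erase p).card • (η + 2 * δ) := Finset.sum_le_card_nsmul _ _ _ fun q hq =>
          hinter p hp q (Finset.mem_of_mem_erase hq) (Finset.ne_of_mem_erase hq).symm
      _ = r * (η + 2 * δ) := by rw [Finset.card_erase_of_mem hp, hK, nsmul_eq_mul]; simp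
  have h1 := Finset.sum_le_sum hinner
  rw [Finset.sum_add_distrib, Finset.sum_const, hK, nsmul_eq_mul] at h1
  have h2 : (K.card : ℝ) * (1 / (r : ℝ) - η - δ) ≤ ∑ p ∈ K, M (L p)ᶜ := by
    rw [← nsmul_eq_mul]
    exact Finset.card_nsmul_le_sum _ _ _ hlow
  rw [hK] at h2
  push_cast at h1 h2
  have h3 : ((r : ℝ) + 1) * (1 / r) = 1 + 1 / r := by field_simp
  nlinarith

end LightNeighbors

/-! ### From the extremal configuration to cliques of G. -/

section Counting

variable {V : Type*} [Fintype V] [DecidableEq V]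

theorem card_cliquesIn_le_card_cliqueFinset {G : SimpleGraph V} [DecidableRel G.Adj] {k : ℕ}
    {B : Finset V} {p q : V} (hpq : G.Adj p q) (hp : ∀ z ∈ B, G.Adj p z)
    (hq : ∀ z ∈ B, G.Adj q z) : (cliquesIn G k B).card ≤ (G.cliqueFinset (k + 2)).card := by
  have hqK : ∀ K ∈ cliquesIn G k B, q ∉ K := fun K hK h =>
    G.irrefl (hq q (((mem_cliquesIn G).1 hK).1 h))
  have hpK : ∀ K ∈ cliquesIn G k B, p ∉ insert q K := fun K hK h => by
    rcases Finset.mem_insert.1 h with h | h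
    · exact hpq.ne h
    · exact G.irrefl (hp p (((mem_cliquesIn G).1 hK).1 h))
  refine Finset.card_le_card_of_injOn (fun K => insert p (insert q K)) ?_ ?_
  · intro K hK
    rw [Finset.mem_coe] at hK
    obtain ⟨h1, h2, h3⟩ := (mem_cliquesIn G).1 hK
    rw [Finset.mem_coe, SimpleGraph.mem_cliqueFinset_iff]
    refine SimpleGraph.IsNClique.insert (SimpleGraph.IsNClique.insert ⟨h3, h2⟩ ?_) ?_
    · exact fun z hz => hq z (h1 hz)
    · intro z hz
      rcases Finset.mem_insert.1 hz with rfl | hz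
      · exact hpq
      · exact hp z (h1 hz)
  · intro K hK K' hK' h
    rw [Finset.mem_coe] at hK hK'
    simp only at h
    have h1 : insert q K = insert q K' := by
      rw [← Finset.erase_insert (hpK K hK), h, Finset.erase_insert (hpK K' hK')]
    rw [← Finset.erase_insert (hqK K hK), h1, Finset.erase_insert (hqK K' hK')]

/-- Greedy counting in the common light neighbourhood of two adjacent vertices p, q. Lightness with
respect to the end of larger degree caps the mass of each vertex. The light neighbours of z itself
bound the mass that z misses. -/
theorem IsExtremal.pow_le_card_cliqueFinset {G H : SimpleGraph V} [DecidableRel G.Adj] {a : ℝ}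
    {s x : V → ℝ} (h : IsExtremal G a H s x) (ha : 0 < a) (ha1 : a ≤ 1)
    (hpos : 0 < adjForm H (s * x)) {r : ℕ} (hr : 2 ≤ r)
    (hlarge : (1 - 1 / (r : ℝ)) * adjForm H (s ^ 2) < adjForm H (s * x) ^ 2)
    {δ η τ : ℝ} (hδ : 0 ≤ δ) (hη0 : 0 < η) (hτ : 0 < τ)
    (hη : (r + 1 : ℝ) * (η + δ) + (r + 1) * r / 2 * (η + 2 * δ) < 1 / r)
    (hηδ : (r - 2 : ℝ) * δ ≤ η / 2) (haτ : 1 - 1 / (r : ℝ) - δ ≤ a - 2 / τ) :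
    (η * a * adjForm H (s * x) / (4 * τ ^ 2)) ^ (r - 1) ≤
      ((r - 1).factorial : ℝ) * ((G.cliqueFinset (r + 1)).card : ℝ) := by
  obtain ⟨K, hK, hKx⟩ := h.exists_clique (by omega) hlarge
  have hs : ∀ v ∈ K, 0 < s v := fun v hv => h.scale_pos_of_ne_zero hpos (hKx v hv)
  have hx2 : ∀ v, 0 ≤ (x ^ 2) v := fun v => sq_nonneg (x v)
  have hx1 : ∑ v, (x ^ 2) v = 1 := h.feasible.sum_sq
  have hr0 : (0 : ℝ) < r := by positivity
  set L := lightNbrs H s x τ with hL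
  have hLlow : ∀ u v, H.Adj u v → 0 < s u → 0 < s v →
      1 - 1 / (r : ℝ) - δ ≤ ∑ w ∈ L u, (x ^ 2) w := fun u v huv hu hv =>
    haτ.trans (h.sub_le_sum_lightNbrs ha ha1 hpos hτ hu (nbrSum_pos_of_adj huv hv))
  obtain ⟨p, hp, q, hq, hpq, hB⟩ := exists_pair_sum_inter_ge hx2 hx1 (by omega : 1 ≤ r) K
    hK.card_eq L hη (by
      intro u hu
      obtain ⟨v, hv, hvu⟩ := Finset.exists_mem_ne (by rw [hK.card_eq]; omega : 1 < K.card) u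
      exact hLlow u v (hK.isClique hu hv hvu.symm) (hs u hu) (hs v hv))
  have hadj : H.Adj p q := hK.isClique hp hq hpq
  have hmax := h.le_max_nbrSum hpos hadj (hs p hp) (hs q hq)
  set l := adjForm H (s * x) with hl
  have hal : 0 < a * l := mul_pos ha hpos
  set B := L p ∩ L q with hBdef
  have hBp : ∀ z ∈ B, _ := fun z hz => mem_lightNbrs.1 (Finset.mem_inter.1 hz).1
  have hBq : ∀ z ∈ B, _ := fun z hz => mem_lightNbrs.1 (Finset.mem_inter.1 hz).2
  have hgreedy := pow_le_factorial_mul_card_cliquesIn H hx2 (ρ := 1 / r + δ)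
    (κ := 2 * τ ^ 2 / (a * l)) (β := η / 2) (by positivity) (by positivity) (by positivity)
    (r - 1) B (by
      intro z hz
      obtain ⟨h1, h2, h3⟩ := hBp z hz
      obtain ⟨h1', h2', h3'⟩ := hBq z hz
      constructor
      · have hs1 : s z ^ 2 ≤ 1 := pow_le_one₀ h2.le (h.feasible.s_le_one z)
        have hD : x z ^ 2 * max (nbrSum H (s ^ 2) p) (nbrSum H (s ^ 2) q) ≤ τ ^ 2 * s z ^ 2 := by
          rcases max_choice (nbrSum H (s ^ 2) p) (nbrSum H (s ^ 2) q) with hc | hc <;> rw [hc]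
          · exact h3
          · exact h3'
        have h4 : x z ^ 2 * (a * l / 2) ≤ τ ^ 2 := by
          calc x z ^ 2 * (a * l / 2) ≤ _ := mul_le_mul_of_nonneg_left hmax (sq_nonneg _)
            _ ≤ τ ^ 2 * s z ^ 2 := hD
            _ ≤ τ ^ 2 := mul_le_of_le_one_right (sq_nonneg _) hs1
        rw [Pi.pow_apply, le_div_iff₀ hal]
        linarith
      · have h4 := hLlow z p h1.symm h2 (hs p hp)
        have h5 : ∑ w ∈ L z, (x ^ 2) w ≤ nbrSum H (x ^ 2) z := by
          calc ∑ w ∈ L z, (x ^ 2) w = ∑ w ∈ L z, adjInd H z w * (x ^ 2) w := by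
                refine Finset.sum_congr rfl fun w hw => ?_
                rw [adjInd_of_adj H (mem_lightNbrs.1 hw).1, one_mul]
            _ ≤ _ := Finset.sum_le_sum_of_subset_of_nonneg (Finset.subset_univ _)
                fun w _ _ => mul_nonneg (adjInd_nonneg H z w) (hx2 w)
        have h6 : ∑ v, (1 - adjInd H z v) * (x ^ 2) v = 1 - nbrSum H (x ^ 2) z := by
          simp only [sub_mul, one_mul, Finset.sum_sub_distrib, hx1, nbrSum]
        rw [h6]; linarith)
    (by
      refine le_trans ?_ hB
      have : ((r - 1 : ℕ) : ℝ) = r - 1 := by push_cast [Nat.cast_sub (by omega : 1 ≤ r)]; ring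
      rw [this]
      have e : ((r : ℝ) - 1) * (1 / r + δ) - (1 / r + δ) = 1 - 2 / r + (r - 2) * δ := by
        field_simp; ring
      linarith)
  have hbase : η / 2 / (2 * τ ^ 2 / (a * l)) = η * a * l / (4 * τ ^ 2) := by
    field_simp; ring
  rw [hbase] at hgreedy
  refine hgreedy.trans (mul_le_mul_of_nonneg_left ?_ (by positivity))
  have hsub : cliquesIn H (r - 1) B ⊆ cliquesIn G (r - 1) B := fun C hC => by
    rw [mem_cliquesIn] at hC ⊢
    exact ⟨hC.1, hC.2.1, hC.2.2.mono h.le⟩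
  have := (Finset.card_le_card hsub).trans (card_cliquesIn_le_card_cliqueFinset
    (h.le hadj) (fun z hz => h.le (hBp z hz).1) (fun z hz => h.le (hBq z hz).1))
  rw [show r - 1 + 2 = r + 1 by omega] at this
  exact_mod_cast this

end Counting

/-! ### Comparison of the form with the spectral radius, and the lower bound. -/

section Spectral

theorem adjMatrix_apply_eq_adjInd {V : Type*} (G : SimpleGraph V) [DecidableRel G.Adj]
    (u v : V) : G.adjMatrix ℝ u v = adjInd G u v := by
  by_cases h : G.Adj u v
  · simp [adjInd_of_adj G h, h]
  · simp [adjInd_of_not_adj G h, h]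

variable {V : Type*} [Fintype V] (G : SimpleGraph V) [DecidableRel G.Adj]

theorem adjMatrix_mulVec_eq_nbrSum (f : V → ℝ) (u : V) :
    (G.adjMatrix ℝ).mulVec f u = nbrSum G f u := by
  simp only [Matrix.mulVec, dotProduct, adjMatrix_apply_eq_adjInd, nbrSum]

theorem adjForm_one : adjForm G 1 = 2 * (G.edgeFinset.card : ℝ) := by
  have h1 : ∀ u, nbrSum G 1 u = (G.degree u : ℝ) := by
    intro u
    rw [← adjMatrix_mulVec_eq_nbrSum]
    simp [Matrix.mulVec, dotProduct, SimpleGraph.adjMatrix_apply, SimpleGraph.degree,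
      SimpleGraph.neighborFinset_eq_filter]
  simp only [adjForm, h1, Pi.one_apply, one_mul]
  exact_mod_cast G.sum_degrees_eq_twice_card_edges

variable [DecidableEq V]

theorem adjForm_le_graphSpectralRadius [Nonempty V] (f : V → ℝ) :
    adjForm G f ≤ graphSpectralRadius G * ∑ v, f v ^ 2 := by
  have hA : (G.adjMatrix ℝ).IsHermitian := by
    simp [Matrix.IsHermitian, Matrix.conjTranspose_eq_transpose_of_trivial]
  have hgr := isGreatest_graphSpectralRadius G
  have hpsd : (algebraMap ℝ (Matrix V V ℝ) (graphSpectralRadius G) - G.adjMatrix ℝ).PosSemidef := by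
    rw [Matrix.posSemidef_iff_isHermitian_and_spectrum_nonneg]
    refine ⟨?_, ?_⟩
    · refine Matrix.IsHermitian.sub ?_ hA
      rw [Matrix.algebraMap_eq_diagonal]
      exact Matrix.isHermitian_diagonal _
    · rw [← spectrum.singleton_sub_eq]
      rintro y ⟨_, rfl, z, hz, rfl⟩
      exact sub_nonneg.2 (hgr.2 hz)
  have h := hpsd.dotProduct_mulVec_nonneg f
  rw [Matrix.sub_mulVec, dotProduct_sub, sub_nonneg] at h
  have h1 : star f ⬝ᵥ (G.adjMatrix ℝ).mulVec f = adjForm G f := by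
    simp only [dotProduct, adjMatrix_mulVec_eq_nbrSum, adjForm, star_trivial]
  have h2 : star f ⬝ᵥ (algebraMap ℝ (Matrix V V ℝ) (graphSpectralRadius G)).mulVec f
      = graphSpectralRadius G * ∑ v, f v ^ 2 := by
    rw [Algebra.algebraMap_eq_smul_one, Matrix.smul_mulVec, Matrix.one_mulVec, dotProduct_smul]
    simp [dotProduct, sq]
  rw [h1, h2] at h
  exact h

theorem exists_feasible_abs_graphSpectralRadius_le [Nonempty V] :
    ∃ y : V → ℝ, IsFeasible 1 y ∧ |graphSpectralRadius G| ≤ adjForm G (1 * y) := by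
  have hmem := (isGreatest_graphSpectralRadius G).1
  rw [← Matrix.spectrum_toLin'] at hmem
  obtain ⟨v, hv⟩ := (Module.End.HasEigenvalue.of_mem_spectrum hmem).exists_hasEigenvector
  have hv1 : ∀ u, nbrSum G v u = graphSpectralRadius G * v u := by
    intro u
    have := congrFun hv.apply_eq_smul u
    rwa [Matrix.toLin'_apply, adjMatrix_mulVec_eq_nbrSum, Pi.smul_apply, smul_eq_mul] at this
  set l := graphSpectralRadius G
  set N := ∑ u, v u ^ 2 with hN
  have hNpos : 0 < N := by
    obtain ⟨u, hu⟩ := Function.ne_iff.1 hv.2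
    exact Finset.sum_pos' (fun w _ => sq_nonneg _) ⟨u, Finset.mem_univ u, by
      have : v u ≠ 0 := hu
      positivity⟩
  have hsq : √N ^ 2 = N := Real.sq_sqrt hNpos.le
  have hsN : √N ≠ 0 := (Real.sqrt_pos.2 hNpos).ne'
  have hform : adjForm G v = l * N := by
    simp only [adjForm, hv1, hN, Finset.mul_sum]
    exact Finset.sum_congr rfl fun u _ => by ring
  refine ⟨fun u => |v u| / √N, ⟨fun u => zero_le_one, fun u => le_rfl, fun u => by positivity, ?_⟩,
    ?_⟩
  · simp only [div_pow, hsq, sq_abs, ← Finset.sum_div]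
    exact div_self hNpos.ne'
  · have h1 := abs_adjForm_le G v
    have h2 : (fun u => |v u|) = √N • fun u => |v u| / √N := by
      funext u
      simp only [Pi.smul_apply, smul_eq_mul]
      field_simp
    rw [h2, adjForm_smul, hsq, hform, abs_mul, abs_of_pos hNpos, mul_comm] at h1
    rw [one_mul]
    exact le_of_mul_le_mul_left h1 hNpos

end Spectral

theorem rpow_half_eq_sqrt_pow {m : ℝ} (hm : 0 ≤ m) {r : ℕ} (hr : 1 ≤ r) :
    m ^ (((r : ℝ) - 1) / 2) = √m ^ (r - 1) := by
  rw [Real.sqrt_eq_rpow, ← Real.rpow_natCast, ← Real.rpow_mul hm]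
  congr 1
  push_cast [Nat.cast_sub hr]
  ring

theorem graphSpectralRadius_of_isEmpty {V : Type*} [Fintype V] [DecidableEq V] [IsEmpty V]
    (G : SimpleGraph V) [DecidableRel G.Adj] : graphSpectralRadius G = 0 := by
  rw [graphSpectralRadius, spectrum.of_subsingleton, Real.sSup_empty]

/-- Spectral supersaturation: a graph whose spectral radius exceeds the Turán bound contains many
cliques. -/
theorem exists_const_mul_rpow_le_card_cliqueFinset (r : ℕ) (hr : 2 ≤ r) :
    ∃ c : ℝ, 0 < c ∧
      ∀ (V : Type*) [Fintype V] [DecidableEq V] (G : SimpleGraph V) [DecidableRel G.Adj],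
        (1 - 1 / (r : ℝ)) * (2 * (G.edgeFinset.card : ℝ)) < graphSpectralRadius G ^ 2 →
          c * (G.edgeFinset.card : ℝ) ^ (((r : ℝ) - 1) / 2) ≤
            ((G.cliqueFinset (r + 1)).card : ℝ) := by
  have hr2 : (2 : ℝ) ≤ r := by exact_mod_cast hr
  have hr0 : (0 : ℝ) < r := by linarith
  -- At δ = 0 the left side of the condition in `exists_pair_sum_inter_ge` is (r+1)(r+2)η/2, half of
  -- 1/r here. This leaves room for δ.
  obtain ⟨η, hηdef⟩ : ∃ η : ℝ, η = 1 / (r * (r + 1) * (r + 2)) := ⟨_, rfl⟩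
  have hη0 : 0 < η := by rw [hηdef]; positivity
  have hηr : (r + 1) * (r + 2) * η = 1 / r := by rw [hηdef]; field_simp
  obtain ⟨δ, hδdef⟩ : ∃ δ : ℝ, δ = η / (2 * r) := ⟨_, rfl⟩
  have hδ0 : 0 < δ := by rw [hδdef]; positivity
  have hδr : r * δ = η / 2 := by rw [hδdef]; field_simp
  have hδη : δ ≤ η / 4 := by nlinarith
  have hrr : 1 / (r : ℝ) ≤ 1 / 2 := one_div_le_one_div_of_le (by norm_num) hr2
  have hη1 : η ≤ 1 := by nlinarith [mul_pos hr0 hη0, mul_pos hr0 (mul_pos hr0 hη0)]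
  set a : ℝ := 1 - 1 / r - δ / 2 with hadef
  have hinv : 0 < 1 / (r : ℝ) := by positivity
  have ha0 : 0 < a := by rw [hadef]; linarith
  have ha1 : a ≤ 1 := by rw [hadef]; linarith
  -- Makes a - 2/τ equal to 1 - 1/r - δ exactly. The other δ/2 of slack, in a, supplies the initial
  -- excess δm.
  set τ : ℝ := 4 / δ with hτdef
  have hτ0 : 0 < τ := by positivity
  have hτ2 : 2 / τ = δ / 2 := by rw [hτdef]; field_simp; norm_num
  refine ⟨(η * a * √δ / (4 * τ ^ 2)) ^ (r - 1) / ((r - 1).factorial : ℝ), by positivity, ?_⟩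
  intro V _ _ G _ hG
  rcases isEmpty_or_nonempty V with hV | hV
  · rw [graphSpectralRadius_of_isEmpty] at hG
    have : 0 ≤ (1 - 1 / (r : ℝ)) * (2 * (G.edgeFinset.card : ℝ)) :=
      mul_nonneg (by linarith) (by positivity)
    rw [zero_pow two_ne_zero] at hG
    linarith
  set m : ℝ := (G.edgeFinset.card : ℝ) with hm
  have hm0 : 0 ≤ m := Nat.cast_nonneg _
  obtain ⟨y, hy, hyl⟩ := exists_feasible_abs_graphSpectralRadius_le G
  obtain ⟨H, s, x, hext⟩ := exists_isExtremal G a hy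
  have hstart : δ * m < excess a G 1 y := by
    have h1 : graphSpectralRadius G ^ 2 ≤ adjForm G (1 * y) ^ 2 := by
      rw [← sq_abs]
      exact pow_le_pow_left₀ (abs_nonneg _) hyl 2
    rw [excess, one_pow, adjForm_one]
    rw [hadef]
    linarith
  have hmax := hstart.trans_le (hext.maximal G le_rfl 1 y hy)
  rw [excess] at hmax
  set l := adjForm H (s * x) with hl
  have hl0 : 0 ≤ l := hext.adjForm_nonneg
  have hM0 : 0 ≤ adjForm H (s ^ 2) := adjForm_nonneg H fun v => sq_nonneg (s v)
  have hM : adjForm H (s ^ 2) ≤ 2 * m := by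
    rw [hm, ← adjForm_one, adjForm_eq_sum, adjForm_eq_sum]
    refine Finset.sum_le_sum fun u _ => Finset.sum_le_sum fun v _ => ?_
    have hs0 := hext.feasible.s_nonneg
    have hs1 := hext.feasible.s_le_one
    refine mul_le_mul ?_ ?_ (mul_nonneg (sq_nonneg _) (sq_nonneg _)) (adjInd_nonneg G u v)
    · by_cases huv : H.Adj u v
      · rw [adjInd_of_adj H huv, adjInd_of_adj G (hext.le huv)]
      · rw [adjInd_of_not_adj H huv]; exact adjInd_nonneg G u v
    · exact mul_le_mul (pow_le_one₀ (hs0 u) (hs1 u)) (pow_le_one₀ (hs0 v) (hs1 v))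
        (sq_nonneg _) zero_le_one
  have haM : 0 ≤ a * adjForm H (s ^ 2) := mul_nonneg ha0.le hM0
  have hlm : δ * m < l ^ 2 := by linarith
  have hlpos : 0 < l := by
    refine hl0.lt_of_ne fun h0 => ?_
    rw [← h0] at hlm
    have : 0 ≤ δ * m := by positivity
    rw [zero_pow two_ne_zero] at hlm
    linarith
  have hlarge : (1 - 1 / (r : ℝ)) * adjForm H (s ^ 2) < l ^ 2 := by
    have h1 : δ / 2 * adjForm H (s ^ 2) ≤ δ / 2 * (2 * m) :=
      mul_le_mul_of_nonneg_left hM (by positivity)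
    have h2 : (1 - 1 / (r : ℝ)) * adjForm H (s ^ 2)
        = a * adjForm H (s ^ 2) + δ / 2 * adjForm H (s ^ 2) := by rw [hadef]; ring
    rw [h2]; linarith
  have hcount := hext.pow_le_card_cliqueFinset ha0 ha1 hlpos hr hlarge hδ0.le hη0 hτ0
    (by nlinarith [mul_pos hr0 hη0, mul_pos hr0 (mul_pos hr0 hη0)]) (by linarith)
    (by rw [hτ2, hadef]; linarith)
  have hsqrt : √δ * √m ≤ l := by
    rw [← Real.sqrt_mul hδ0.le]
    exact Real.sqrt_le_iff.2 ⟨hl0, hlm.le⟩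
  rw [rpow_half_eq_sqrt_pow hm0 (by omega), div_mul_eq_mul_div, ← mul_pow,
    div_le_iff₀ (by positivity), mul_comm (((G.cliqueFinset (r + 1)).card : ℝ))]
  refine le_trans (pow_le_pow_left₀ (by positivity) ?_ _) hcount
  have : η * a * √δ / (4 * τ ^ 2) * √m = η * a / (4 * τ ^ 2) * (√δ * √m) := by ring
  rw [this]
  calc _ ≤ η * a / (4 * τ ^ 2) * l := mul_le_mul_of_nonneg_left hsqrt (by positivity)
    _ = _ := by ring

/-! ### The complete multipartite graph with one added edge. -/

section Tightness

variable {r t : ℕ} {i : Fin r} {a b : Fin t}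

theorem completePartitePlusEdge_adj (hab : a ≠ b) {u v : Σ _ : Fin r, Fin t} :
    (completePartitePlusEdge r t i a b).Adj u v ↔
      u.1 ≠ v.1 ∨ (u = ⟨i, a⟩ ∧ v = ⟨i, b⟩) ∨ (u = ⟨i, b⟩ ∧ v = ⟨i, a⟩) := by
  have hne : (⟨i, a⟩ : Σ _ : Fin r, Fin t) ≠ ⟨i, b⟩ := by simpa using hab
  rw [completePartitePlusEdge, SimpleGraph.sup_adj, SimpleGraph.edge_adj]
  refine or_congr Iff.rfl ⟨fun h => ?_, fun h => ?_⟩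
  · exact h.1
  · rcases h with ⟨rfl, rfl⟩ | ⟨rfl, rfl⟩
    · exact ⟨by simp, hne⟩
    · exact ⟨by simp, hne.symm⟩

theorem adjForm_one_completePartitePlusEdge (hab : a ≠ b) :
    adjForm (completePartitePlusEdge r t i a b) 1 = r * (r - 1) * t ^ 2 + 2 := by
  set A : Σ _ : Fin r, Fin t := ⟨i, a⟩ with hA
  set B : Σ _ : Fin r, Fin t := ⟨i, b⟩ with hB
  have hne : A ≠ B := by simpa [hA, hB] using hab
  have key : ∀ u v, adjInd (completePartitePlusEdge r t i a b) u v =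
      (1 - if u.1 = v.1 then 1 else 0) + (if u = A then if v = B then 1 else 0 else 0)
        + (if u = B then if v = A then 1 else 0 else 0) := by
    intro u v
    by_cases h1 : u = A ∧ v = B
    · obtain ⟨rfl, rfl⟩ := h1
      rw [adjInd_of_adj _ ((completePartitePlusEdge_adj hab).2 (Or.inr (Or.inl ⟨rfl, rfl⟩)))]
      simp [hA, hB, hab]
    · by_cases h2 : u = B ∧ v = A
      · obtain ⟨rfl, rfl⟩ := h2
        rw [adjInd_of_adj _ ((completePartitePlusEdge_adj hab).2 (Or.inr (Or.inr ⟨rfl, rfl⟩)))]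
        simp [hA, hB, hab.symm]
      · rw [← ite_and, ← ite_and, if_neg h1, if_neg h2]
        by_cases h3 : u.1 = v.1
        · rw [adjInd_of_not_adj]
          · simp [h3]
          · rw [completePartitePlusEdge_adj hab]; tauto
        · rw [adjInd_of_adj]
          · simp [h3]
          · rw [completePartitePlusEdge_adj hab]; tauto
  rw [adjForm_eq_sum]
  simp only [key, Pi.one_apply, mul_one, Finset.sum_add_distrib, Finset.sum_sub_distrib]
  have hcount : ∀ u : Σ _ : Fin r, Fin t,
      ∑ v : Σ _ : Fin r, Fin t, (if u.1 = v.1 then (1 : ℝ) else 0) = t := by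
    intro u
    rw [Fintype.sum_sigma, Finset.sum_eq_single u.1]
    · simp
    · intro j _ hj
      simp [hj.symm]
    · simp
  simp only [hcount]
  simp [Finset.sum_ite_irrel]
  ring

/-- A clique missing an end of the added edge meets each of the r parts at most once. -/
theorem mem_of_isNClique_completePartitePlusEdge (hab : a ≠ b)
    {K : Finset (Σ _ : Fin r, Fin t)}
    (hK : (completePartitePlusEdge r t i a b).IsNClique (r + 1) K) :
    ⟨i, a⟩ ∈ K ∧ ⟨i, b⟩ ∈ K := by
  by_contra hcon
  have hinj : Set.InjOn Sigma.fst (K : Set (Σ _ : Fin r, Fin t)) := by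
    intro u hu v hv huv
    by_contra hne
    rcases (completePartitePlusEdge_adj hab).1 (hK.isClique hu hv hne) with
      h | ⟨rfl, rfl⟩ | ⟨rfl, rfl⟩
    · exact h huv
    · exact hcon ⟨hu, hv⟩
    · exact hcon ⟨hv, hu⟩
  have h1 := Finset.card_le_card_of_injOn (t := Finset.univ) Sigma.fst
    (fun _ _ => Finset.mem_coe.2 (Finset.mem_univ _)) hinj
  rw [hK.card_eq, Finset.card_univ, Fintype.card_fin] at h1
  omega

theorem card_cliqueFinset_completePartitePlusEdge_le (hr : 1 ≤ r) (hab : a ≠ b) :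
    ((completePartitePlusEdge r t i a b).cliqueFinset (r + 1)).card ≤ (r * t) ^ (r - 1) := by
  set A : Σ _ : Fin r, Fin t := ⟨i, a⟩ with hA
  set B : Σ _ : Fin r, Fin t := ⟨i, b⟩ with hB
  have hne : A ≠ B := by simpa [hA, hB] using hab
  have hsub : ∀ K ∈ (completePartitePlusEdge r t i a b).cliqueFinset (r + 1), {A, B} ⊆ K := by
    intro K hK
    have := mem_of_isNClique_completePartitePlusEdge hab (SimpleGraph.mem_cliqueFinset_iff.1 hK)
    exact Finset.insert_subset this.1 (Finset.singleton_subset_iff.2 this.2)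
  have h1 : ((completePartitePlusEdge r t i a b).cliqueFinset (r + 1)).card ≤
      ((Finset.univ : Finset (Σ _ : Fin r, Fin t)).powersetCard (r - 1)).card := by
    refine Finset.card_le_card_of_injOn (fun K => K \ {A, B}) ?_ ?_
    · intro K hK
      rw [Finset.mem_coe] at hK
      rw [Finset.mem_coe, Finset.mem_powersetCard]
      refine ⟨Finset.subset_univ _, ?_⟩
      rw [Finset.card_sdiff_of_subset (hsub K hK), Finset.card_pair hne,
        (SimpleGraph.mem_cliqueFinset_iff.1 hK).card_eq]
      omega
    · intro K hK K' hK' h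
      rw [Finset.mem_coe] at hK hK'
      rw [← Finset.sdiff_union_of_subset (hsub K hK), ← Finset.sdiff_union_of_subset (hsub K' hK')]
      exact congrArg (· ∪ {A, B}) h
  refine h1.trans ?_
  rw [Finset.card_powersetCard]
  refine (Nat.choose_le_pow _ _).trans ?_
  simp [Finset.card_univ, Fintype.card_sigma]

theorem card_edgeFinset_completePartitePlusEdge (hab : a ≠ b) :
    (completePartitePlusEdge r t i a b).edgeFinset.card = r.choose 2 * t ^ 2 + 1 := by
  have h1 := adjForm_one_completePartitePlusEdge (i := i) hab
  rw [adjForm_one] at h1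
  have h2 : ((completePartitePlusEdge r t i a b).edgeFinset.card : ℝ)
      = ((r.choose 2 * t ^ 2 + 1 : ℕ) : ℝ) := by
    push_cast
    rw [Nat.cast_choose_two]
    linarith
  exact_mod_cast h2

theorem lt_graphSpectralRadius_completePartitePlusEdge_sq (hr : 1 ≤ r) (ht : 1 ≤ t)
    (hab : a ≠ b) :
    (1 - 1 / (r : ℝ)) * (2 * ((completePartitePlusEdge r t i a b).edgeFinset.card : ℝ)) <
      graphSpectralRadius (completePartitePlusEdge r t i a b) ^ 2 := by
  have : Nonempty (Σ _ : Fin r, Fin t) := ⟨⟨i, a⟩⟩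
  have h1 := adjForm_le_graphSpectralRadius (completePartitePlusEdge r t i a b) 1
  have hsum : ∑ v : Σ _ : Fin r, Fin t, (1 : (Σ _ : Fin r, Fin t) → ℝ) v ^ 2 = r * t := by
    simp
  rw [hsum] at h1
  rw [← adjForm_one]
  have hX := adjForm_one_completePartitePlusEdge (i := i) hab
  set X := adjForm (completePartitePlusEdge r t i a b) 1
  set l := graphSpectralRadius (completePartitePlusEdge r t i a b)
  have hr1 : (1 : ℝ) ≤ r := by exact_mod_cast hr
  have ht1 : (1 : ℝ) ≤ t := by exact_mod_cast ht
  have hXpos : 0 < X := by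
    rw [hX]
    have : (0 : ℝ) ≤ r * (r - 1) * t ^ 2 := by
      have : (0 : ℝ) ≤ r - 1 := by linarith
      positivity
    linarith
  have hrt : (0 : ℝ) < (r * t) ^ 2 := by positivity
  have h2 : X ^ 2 ≤ l ^ 2 * (r * t) ^ 2 := by
    rw [← mul_pow]
    exact pow_le_pow_left₀ hXpos.le h1 2
  -- The all-ones vector gives X ≤ λ·rt. The strict inequality comes from the 2 that the added edge
  -- contributes to X.
  have h3 : (1 - 1 / (r : ℝ)) * X * (r * t) ^ 2 = X * (X - 2) := by
    have : X - 2 = r * (r - 1) * t ^ 2 := by linarith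
    rw [this]
    field_simp
  refine lt_of_mul_lt_mul_right ?_ hrt.le
  rw [h3]
  nlinarith

end Tightness

theorem mainTheorem7 (r : ℕ) (hr : 2 ≤ r) :
    (∃ c : ℝ, 0 < c ∧
      ∀ (V : Type*) [Fintype V] [DecidableEq V] (G : SimpleGraph V) [DecidableRel G.Adj],
        (1 - 1 / (r : ℝ)) * (2 * (G.edgeFinset.card : ℝ)) < graphSpectralRadius G ^ 2 →
          c * (G.edgeFinset.card : ℝ) ^ (((r : ℝ) - 1) / 2) ≤
            ((G.cliqueFinset (r + 1)).card : ℝ)) ∧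
    (∃ C : ℝ, 0 < C ∧
      ∀ (t : ℕ), 2 ≤ t → ∀ (i : Fin r) (a b : Fin t), a ≠ b →
        (completePartitePlusEdge r t i a b).edgeFinset.card = r.choose 2 * t ^ 2 + 1 ∧
        (1 - 1 / (r : ℝ)) * (2 * ((completePartitePlusEdge r t i a b).edgeFinset.card : ℝ)) <
          graphSpectralRadius (completePartitePlusEdge r t i a b) ^ 2 ∧
        (((completePartitePlusEdge r t i a b).cliqueFinset (r + 1)).card : ℝ) ≤
          C * ((completePartitePlusEdge r t i a b).edgeFinset.card : ℝ) ^
            (((r : ℝ) - 1) / 2)) := by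
  refine ⟨exists_const_mul_rpow_le_card_cliqueFinset r hr, (r : ℝ) ^ (r - 1), by positivity, ?_⟩
  intro t ht i a b hab
  have hm := card_edgeFinset_completePartitePlusEdge (i := i) hab
  refine ⟨hm, lt_graphSpectralRadius_completePartitePlusEdge_sq (by omega) (by omega) hab, ?_⟩
  rw [rpow_half_eq_sqrt_pow (Nat.cast_nonneg _) (by omega), ← mul_pow]
  have h1 : (((completePartitePlusEdge r t i a b).cliqueFinset (r + 1)).card : ℝ)
      ≤ ((r : ℝ) * t) ^ (r - 1) := by
    exact_mod_cast card_cliqueFinset_completePartitePlusEdge_le (by omega) hab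
  refine h1.trans (pow_le_pow_left₀ (by positivity) ?_ _)
  refine mul_le_mul_of_nonneg_left (Real.le_sqrt_of_sq_le ?_) (by positivity)
  rw [hm]
  have h2 : 1 ≤ r.choose 2 := Nat.choose_pos hr
  have h3 : t ^ 2 ≤ r.choose 2 * t ^ 2 + 1 := by nlinarith
  exact_mod_cast h3
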